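/- **Proposition (critical points move smoothly, converge to critical sets or diverge).** Let $H\ge 0$, let $d_0,\dots,d_{H+1}$ and $m$ be natural numbers, and let $X\in\mathbb R^{d_0\times m}$ and $Y\in\mathbb R^{d_{H+1}\times m}$. For $W=(W_1,\dots,W_{H+1})$ with $W_i\in\mathbb R^{d_i\times d_{i-1}}$ let $$\bar{\mathcal L}(W)=\tfrac12\sum_{c=1}^m\big\|(W_{H+1}\cdots W_1X)_{\cdot,c}-Y_{\cdot,c}\big\|_2^2,$$ and, for $\Lambda=(\Lambda_1,\dots,\Lambda_{H+1})$ with $\Lambda_i\in\mathbb R^{d_i\times d_{i-1}}$, $$\mathcal L^\Lambda(W)=\bar{\mathcal L}(W)+\tfrac12\sum_{i=1}^{H+1}\|\Lambda_i\circ W_i\|_F^2,$$ where $\circ$ is the entrywise product. A critical point is a real zero of the gradient; it is nondegenerate if the Hessian there is nonsingular. Write $\mathrm{Crit}(\bar{\mathcal L})$ for the set of critical points of $\bar{\mathcal L}$. Then the following hold. 1. For Lebesgue-almost every $\Lambda$ with positive entries there is $\varepsilon>0$ such that for all $t\in(0,\varepsilon)$ every critical point of $\mathcal L^{t\Lambda}$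 is nondegenerate. 2. For every $\Lambda$ with positive entries there are $\varepsilon>0$ and finitely many $C^\infty$ curves $\gamma_1,\dots,\gamma_N$ on $(0,\varepsilon)$ with values in the space of weights such that for every $t\in(0,\varepsilon)$ the points $\gamma_1(t),\dots,\gamma_N(t)$ are distinct and are exactly the nondegenerate critical points of $\mathcal L^{t\Lambda}$ (hence, for almost every $\Lambda$ and after shrinking $\varepsilon$, all its critical points). As $t\to0^+$, each $\gamma_p(t)$ either converges to a point of $\mathrm{Crit}(\bar{\mathcal L})$, or diverges to infinity in the sense that $|w(t)|\to\infty$ for some coordinate $w$ of $\gamma_p$. 3. Let $t\mapsto\Lambda(t)$, $t>0$, be any family with positive entries such that all entries of $\Lambda(t)$ tend to $0$ as $t\to0^+$, and for each $t>0$ let $\gamma(t)$ be any critical point of $\mathcal L^{\Lambda(t)}$. Then either $\gamma(t)$ converges to the set $\mathrm{Crit}(\bar{\mathcal L})$ as $t\to0^+$, that is, for every open $U\supseteq\mathrm{Crit}(\bar{\mathcal L})$ one has $\gamma(t)\in U$ for all sufficiently small $t>0$; or some coordinate of $\gamma(t)$ is unbounded as $t\to0^+$, that is, its absolute value exceeds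 any given constant for arbitrarily small $t>0$. -/

import Mathlib

open Set Filter Topology MeasureTheory
open scoped ContDiff

namespace DeepLinear

/-- The space of tuples `(W₁, …, W_n)` of real matrices, where the layer with index `i` (counted
from `0`) has `d (i + 1)` rows and `d i` columns. It is a finite product of copies of `ℝ`, with its
usual topology, smooth structure and Lebesgue measure. -/
abbrev Weights (d : ℕ → ℕ) (n : ℕ) : Type :=
  (i : Fin n) → Fin (d (i + 1)) → Fin (d i) → ℝ

/-- The product `W_n ⋯ W₂ W₁` of all the weight matrices. -/
def netProd (d : ℕ → ℕ) : (n : ℕ) → Weights d n → Matrix (Fin (d n)) (Fin (d 0)) ℝ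
  | 0, _ => 1
  | n + 1, W =>
    (Matrix.of (W (Fin.last n)) : Matrix (Fin (d (n + 1))) (Fin (d n)) ℝ) *
      netProd d n (fun i => W i.castSucc)

/-- The unregularized loss `½ ∑_c ‖(W_{H+1} ⋯ W₁ X)_{·,c} - Y_{·,c}‖₂²` of a deep linear network
with `H` hidden layers, input dimension `d 0`, hidden widths `d 1, …, d H`, output dimension
`d (H + 1)` and `m` data points. -/
noncomputable def loss {H m : ℕ} {d : ℕ → ℕ} (X : Matrix (Fin (d 0)) (Fin m) ℝ)
    (Y : Matrix (Fin (d (H + 1))) (Fin m) ℝ) (W : Weights d (H + 1)) : ℝ :=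
  (1 / 2) * ∑ c, ∑ r, ((netProd d (H + 1) W * X) r c - Y r c) ^ 2

/-- The generalized Tikhonov regularization
`loss W + ½ (‖Λ₁ ∘ W₁‖_F² + ⋯ + ‖Λ_{H+1} ∘ W_{H+1}‖_F²)`, with entrywise products. -/
noncomputable def regLoss {H m : ℕ} {d : ℕ → ℕ} (X : Matrix (Fin (d 0)) (Fin m) ℝ)
    (Y : Matrix (Fin (d (H + 1))) (Fin m) ℝ) (Λ W : Weights d (H + 1)) : ℝ :=
  loss X Y W + (1 / 2) * ∑ i, ∑ j, ∑ k, (Λ i j k * W i j k) ^ 2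

/-- `x` is a critical point of `f`: the derivative of `f` vanishes at `x`. -/
def IsCritical {E : Type*} [NormedAddCommGroup E] [NormedSpace ℝ E] (f : E → ℝ) (x : E) : Prop :=
  fderiv ℝ f x = 0

/-- `x` is a nondegenerate critical point of `f`: a critical point at which the Hessian of `f`,
as a linear map from the space to its dual, is nonsingular (has zero kernel). -/
def IsNondegenerateCritical {E : Type*} [NormedAddCommGroup E] [NormedSpace ℝ E]
    (f : E → ℝ) (x : E) : Prop :=
  IsCritical f x ∧ ∀ v, fderiv ℝ (fderiv ℝ f) x v = 0 → v = 0

end DeepLinear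

/-! In the entries of `W` the loss is a polynomial `p`, and the regularized loss is `p + ½ ∑ cᵢ xᵢ²`
with `cᵢ = Λᵢ²`. Nothing else about the network is used.

Nondegeneracy for generic `c` is algebraic (`det_hess_ne_zero_of_algebraicIndependent`). If the `cᵢ`
are algebraically independent in a field, there are derivations `∂/∂c_z`. Applied to the critical
equations at `x`, they give `Hess · ∂x/∂c_z = -x_z e_z`, which handles the coordinates with `x_z ≠
0`. If `x_z = 0`, then `x` does not depend on `c_z`, while the determinant is affine in `c_z` with a
nonzero leading coefficient. A prime ideal argument turns this into a polynomial `q ≠ 0` vanishing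
at every degenerate `c`. For almost every `Λ`, `q` does not vanish identically on the curve `t ↦
(tΛ)²`, so it has no zeros there for small `t > 0`.

Over `ℝ[t]` the scheme of nondegenerate critical points is unramified, so the coordinates and the
inverse Hessian determinant are algebraic functions of `t`. Where the leading coefficients of their
equations do not vanish, both are locally bounded. With the implicit function theorem, the critical
points then form a finite covering of `(0, ε)`, which splits into smooth sections
(`exists_smooth_sections`). A continuous algebraic function has a limit in `[-∞, ∞]`
(`tendsto_of_algebraic`), and the critical equations pass to finite limits.

The last claim is compactness: cluster points of bounded critical points are critical for `p`. -/

namespace DeepLinear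
open MvPolynomial
open scoped TensorProduct

/-! ### Critical equations and Hessians over arbitrary `ℝ`-algebras. -/

section Algebra
variable {σ : Type*}

/-- The partial derivatives of the polynomial `p + ½ ∑ cᵢ xᵢ²` at the point `x` of an
`ℝ`-algebra. -/
noncomputable def critEq {A : Type*} [CommRing A] [Algebra ℝ A] (p : MvPolynomial σ ℝ)
    (c x : σ → A) (i : σ) : A :=
  aeval x (pderiv i p) + c i * x i

/-- The Hessian matrix of the polynomial `p + ½ ∑ cᵢ xᵢ²` at the point `x` of an `ℝ`-algebra. -/
noncomputable def hess [DecidableEq σ] {A : Type*} [CommRing A] [Algebra ℝ A] (p : MvPolynomial σ ℝ)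
    (c x : σ → A) : Matrix σ σ A :=
  Matrix.of (fun i j => aeval x (pderiv j (pderiv i p))) + Matrix.diagonal c

variable {A B : Type*} [CommRing A] [Algebra ℝ A] [CommRing B] [Algebra ℝ B]

/-- Naturality transports critical points between polynomial rings, their quotients, residue fields
and `ℝ`. -/
lemma map_critEq (f : A →ₐ[ℝ] B) (p : MvPolynomial σ ℝ) (c x : σ → A) (i : σ) :
    f (critEq p c x i) = critEq p (f ∘ c) (f ∘ x) i := by
  simp only [critEq, map_add, map_mul, Function.comp_apply]
  rw [← AlgHom.comp_apply, comp_aeval]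
  rfl

lemma map_hess [DecidableEq σ] (f : A →ₐ[ℝ] B) (p : MvPolynomial σ ℝ) (c x : σ → A) :
    (hess p c x).map f = hess p (f ∘ c) (f ∘ x) := by
  ext i j
  simp only [hess, Matrix.map_apply, Matrix.add_apply, Matrix.of_apply, map_add]
  rw [← AlgHom.comp_apply, comp_aeval]
  congr 1
  by_cases h : i = j
  · subst h; simp
  · simp [h]

lemma map_det_hess [Fintype σ] [DecidableEq σ] (f : A →ₐ[ℝ] B) (p : MvPolynomial σ ℝ) (c x : σ → A) :
    f (hess p c x).det = (hess p (f ∘ c) (f ∘ x)).det := by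
  rw [AlgHom.map_det, AlgHom.mapMatrix_apply, map_hess]

section Derivation
variable {M : Type*} [AddCommGroup M] [Module A M] [Module ℝ M]
  (D : Derivation ℝ A M)

lemma derivation_aeval [Fintype σ] (x : σ → A) (q : MvPolynomial σ ℝ) :
    D (aeval x q) = ∑ j, aeval x (pderiv j q) • D (x j) := by
  induction q using MvPolynomial.induction_on with
  | C a => simp
  | add p q hp hq => simp [hp, hq, add_smul, Finset.sum_add_distrib]
  | mul_X p i hp =>
    classical
    simp only [map_mul, aeval_X, Derivation.leibniz, hp, Finset.smul_sum, pderiv_X, smul_eq_mul,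
      map_add, add_smul, Finset.sum_add_distrib, mul_smul]
    congr 1
    rw [Finset.sum_eq_single i]
    · simp
    · intro j _ hj; simp [hj.symm]
    · simp

/-- Implicit differentiation: at a critical point the left side is zero, which leaves a linear
system for the `D (x j)` with the Hessian as its matrix. -/
lemma derivation_critEq [Fintype σ] [DecidableEq σ] (p : MvPolynomial σ ℝ) (c x : σ → A) (i : σ) :
    D (critEq p c x i) = ∑ j, hess p c x i j • D (x j) + x i • D (c i) := by
  simp only [critEq, map_add, Derivation.leibniz, derivation_aeval, hess, Matrix.add_apply,
    Matrix.of_apply, add_smul, Finset.sum_add_distrib]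
  rw [add_assoc]
  congr 2
  rw [Finset.sum_eq_single i]
  · simp
  · intro j _ hj; simp [hj.symm]
  · simp

end Derivation
end Algebra

/-- In characteristic zero, derivations of a field can be prescribed arbitrarily on an algebraically
independent family. -/
lemma exists_derivation_of_algebraicIndependent {k L σ : Type*} [Field k] [CharZero k] [Field L]
    [Algebra k L] {c : σ → L} (hc : AlgebraicIndependent k c) (v : σ → L) :
    ∃ D : Derivation k L L, ∀ i, D (c i) = v i := by
  classical
  -- Extend `c` to a transcendence basis `t`. Then `k[t] → k(t) → L` is a localization followed by a
  -- separable algebraic extension, hence formally étale, and derivations of `k[t]` into `L` extend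
  -- to `L`.
  obtain ⟨t, hct, ht⟩ := exists_isTranscendenceBasis_superset hc.coe_range
  let : Algebra (MvPolynomial t k) L := (aeval ((↑) : t → L)).toAlgebra
  have hmap : ∀ q : MvPolynomial t k, algebraMap (MvPolynomial t k) L q = aeval (↑) q :=
    fun _ => rfl
  have : IsScalarTower k (MvPolynomial t k) L := IsScalarTower.of_algHom (aeval ((↑) : t → L))
  have hinj : Function.Injective (algebraMap (MvPolynomial t k) L) := ht.1
  let K := FractionRing (MvPolynomial t k)
  have : FaithfulSMul (MvPolynomial t k) L := (faithfulSMul_iff_algebraMap_injective _ _).2 hinj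
  let : Algebra K L := FractionRing.liftAlgebra _ _
  have : IsScalarTower (MvPolynomial t k) K L := FractionRing.isScalarTower_liftAlgebra _ _
  have : Algebra.IsAlgebraic (MvPolynomial t k) L :=
    have := ht.isAlgebraic
    Algebra.IsAlgebraic.of_ringHom_of_comp_eq 
      (ht.1.aevalEquiv : MvPolynomial t k →+* Algebra.adjoin k (range ((↑) : t → L))) (RingHom.id L)
      ht.1.aevalEquiv.surjective Function.injective_id (RingHom.ext fun _ => rfl)
  have : Algebra.IsAlgebraic K L := (IsFractionRing.comap_isAlgebraic_iff (A := MvPolynomial t k)).1 this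
  have : Algebra.FormallyEtale (MvPolynomial t k) K :=
    Algebra.FormallyEtale.of_isLocalization (nonZeroDivisors _)
  have : CharZero K := charZero_of_injective_algebraMap (IsFractionRing.injective (MvPolynomial t k) K)
  have : Algebra.FormallyEtale K L := Algebra.FormallyEtale.of_isSeparable K L
  have : Algebra.FormallyEtale (MvPolynomial t k) L := .comp _ K _
  -- Basis elements outside the family `c` get derivative `0`.
  let w : t → L := fun b => if h : ∃ i, c i = b then v h.choose else 0
  let φ := (mkDerivation k w).liftKaehlerDifferential
  let ψ := φ.liftBaseChange L
  let e := KaehlerDifferential.tensorKaehlerEquivOfFormallyEtale k (MvPolynomial t k) L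
  refine ⟨(ψ ∘ₗ e.symm.toLinearMap).compDer (KaehlerDifferential.D k L), fun i => ?_⟩
  have hx : c i = algebraMap (MvPolynomial t k) L (X ⟨c i, hct ⟨i, rfl⟩⟩) := by simp [hmap]
  have hex : ∃ j, c j = c i := ⟨i, rfl⟩
  have hch : hex.choose = i := hc.injective hex.choose_spec
  conv_lhs => rw [hx]
  change ψ (e.symm (KaehlerDifferential.D k L (algebraMap _ _ _))) = _
  rw [KaehlerDifferential.tensorKaehlerEquivOfFormallyEtale_symm_D_algebraMap]
  simp [ψ, φ, w, hch]

/-! ### Generic nondegeneracy and algebraicity of critical points. -/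

section
variable {σ : Type*} [Fintype σ] [DecidableEq σ]

lemma derivation_det_eq_zero {A M : Type*} [CommRing A] [Algebra ℝ A] [AddCommGroup M] [Module A M]
    [Module ℝ M] (D : Derivation ℝ A M) (N : Matrix σ σ A) (h : ∀ i j, D (N i j) = 0) :
    D N.det = 0 := by
  have key : ∀ (f : σ → A) (s : Finset σ), (∀ i, D (f i) = 0) → D (∏ i ∈ s, f i) = 0 := by
    intro f s hf
    induction s using Finset.induction_on with
    | empty => simp
    | insert a s ha ih => simp [Finset.prod_insert ha, ih, hf]
  simp only [Matrix.det_apply, map_sum]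
  refine Finset.sum_eq_zero fun τ _ => ?_
  rcases Int.units_eq_one_or (Equiv.Perm.sign τ) with hτ | hτ <;>
    simp [hτ, key _ _ fun i => h _ _]

/-- If the coefficients `c` are generic, then every critical point of `p + ½ ∑ cᵢ xᵢ²` in a field
is nondegenerate. -/
theorem det_hess_ne_zero_of_algebraicIndependent {L : Type*} [Field L] [Algebra ℝ L]
    (p : MvPolynomial σ ℝ) {c : σ → L} (hc : AlgebraicIndependent ℝ c) {x : σ → L}
    (hx : ∀ i, critEq p c x i = 0) : (hess p c x).det ≠ 0 := by
  classical
  choose D hD using fun z : σ => exists_derivation_of_algebraicIndependent hc (Pi.single z 1)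
  -- Rows in `S` come from the Hessian, the others from the identity; the aim is to enlarge `S` from
  -- `N` to everything with the determinant staying nonzero.
  let M : Finset σ → Matrix σ σ L :=
    fun S => Matrix.of fun i => if i ∈ S then hess p c x i else Pi.single i 1
  let N : Finset σ := Finset.univ.filter fun i => x i ≠ 0
  have hN : ∀ i, i ∉ N → x i = 0 := by simp [N]
  have key : ∀ z, Matrix.mulVec (M N) (fun j => D z (x j)) = Pi.single z (-x z) := by
    intro z
    ext i
    have h := derivation_critEq (D z) p c x i
    rw [hx i, map_zero, hD] at h
    by_cases hi : i ∈ N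
    · have : Matrix.mulVec (M N) (fun j => D z (x j)) i = ∑ j, hess p c x i j * D z (x j) := by
        simp [M, Matrix.mulVec, dotProduct, hi]
      rw [this]
      simp only [smul_eq_mul] at h
      rw [eq_neg_of_add_eq_zero_left h.symm]
      by_cases hz : i = z
      · subst hz; simp
      · simp [hz]
    · have : Matrix.mulVec (M N) (fun j => D z (x j)) i = D z (x i) := by
        simp [M, Matrix.mulVec, hi]
      rw [this, hN i hi, map_zero]
      by_cases hz : i = z
      · subst hz; simp [hN i hi]
      · simp [hz]
  have hdetN : (M N).det ≠ 0 := by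
    intro h0
    -- Pairing a left null vector `u` with `key` gives `u z * x z = 0`, so `u` vanishes on `N`; on
    -- the remaining rows `M N` is the identity.
    obtain ⟨u, hu, hu0⟩ := Matrix.exists_vecMul_eq_zero_iff.2 h0
    have h1 : ∀ z ∈ N, u z = 0 := by
      intro z hz
      have := Matrix.dotProduct_mulVec u (M N) (fun j => D z (x j))
      rw [hu0, key, zero_dotProduct, dotProduct_single] at this
      have hxz : x z ≠ 0 := by simpa [N] using hz
      simpa [hxz] using this
    apply hu
    ext j
    by_cases hj : j ∈ N
    · exact h1 j hj
    · have := congrFun hu0 j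
      rw [Matrix.vecMul, dotProduct, Finset.sum_eq_single j] at this
      · simpa [M, hj] using this
      · intro i _ hij
        by_cases hi : i ∈ N
        · simp [h1 i hi]
        · simp [M, hi, hij.symm]
      · simp
  have hDx : ∀ z, z ∉ N → ∀ j, D z (x j) = 0 := by
    intro z hz
    refine congrFun (Matrix.eq_zero_of_mulVec_eq_zero hdetN ?_)
    rw [key, hN z hz]
    simp
  have hDa : ∀ z, z ∉ N → ∀ q : MvPolynomial σ ℝ, D z (aeval x q) = 0 := by
    intro z hz q
    simp [derivation_aeval, hDx z hz]
  have step : ∀ T : Finset σ, (M (N ∪ T)).det ≠ 0 := by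
    intro T
    induction T using Finset.induction_on with
    | empty => simpa using hdetN
    | insert z T _ ih =>
      rw [Finset.union_insert]
      set S := N ∪ T
      by_cases hzS : z ∈ S
      · rwa [Finset.insert_eq_of_mem hzS]
      have hzN : z ∉ N := fun h => hzS (Finset.mem_union_left _ h)
      -- The new row is `c z` times a unit vector plus `r`, so `det M (insert z S) = c z * det M S +
      -- det (row z replaced by r)`. Both determinants are killed by `D z`, so if the sum were zero,
      -- applying `D z` would give `det M S = 0`.
      let r : σ → L := fun j => aeval x (pderiv j (pderiv z p))
      have hrow : M (insert z S) =
          (M S).updateRow z (c z • Pi.single z 1 + r) := by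
        ext i j
        by_cases hi : i = z
        · subst hi
          by_cases hj : i = j
          · subst hj; simp [M, hess, r, add_comm]
          · simp [M, hess, r, hj, Ne.symm hj]
        · simp [M, hi]
      have hself : (M S).updateRow z (Pi.single z 1) = M S := by
        convert Matrix.updateRow_eq_self (M S) z using 2
        ext j
        simp [M, hzS]
      rw [hrow, Matrix.det_updateRow_add, Matrix.det_updateRow_smul, hself]
      have hrows : ∀ i j, D z (M S i j) = 0 := by
        intro i j
        by_cases hi : i ∈ S
        · have hiz : i ≠ z := fun h => hzS (h ▸ hi)
          by_cases hij : i = j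
          · subst hij; simp [M, hi, hess, hDa z hzN, hD, hiz]
          · simp [M, hi, hess, hDa z hzN, hij]
        · by_cases hij : j = i
          · subst hij; simp [M, hi]
          · simp [M, hi, hij]
      have h1 : D z (M S).det = 0 := derivation_det_eq_zero _ _ hrows
      have h2 : D z ((M S).updateRow z r).det = 0 := by
        refine derivation_det_eq_zero _ _ fun i j => ?_
        by_cases hi : i = z
        · subst hi; simp [r, hDa i hzN]
        · simp [hi, hrows]
      intro h0
      apply ih
      have := congrArg (D z) h0
      simpa [h1, h2, hD] using this
  have := step Finset.univ
  rw [Finset.union_eq_right.2 (Finset.subset_univ _)] at this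
  convert this using 2
  ext i j
  simp [M]

/-- The coefficients for which `p + ½ ∑ cᵢ xᵢ²` has a degenerate critical point satisfy a nontrivial
polynomial equation. -/
theorem exists_polynomial_degenerate (p : MvPolynomial σ ℝ) :
    ∃ q : MvPolynomial σ ℝ, q ≠ 0 ∧ ∀ c x : σ → ℝ, (∀ i, critEq p c x i = 0) →
      (hess p c x).det = 0 → eval c q = 0 := by
  let S := MvPolynomial (σ ⊕ σ) ℝ
  let C : σ → S := fun i => X (Sum.inl i)
  let Y : σ → S := fun i => X (Sum.inr i)
  let I : Ideal S := Ideal.span (range (critEq p C Y) ∪ {(hess p C Y).det})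
  let ρ : MvPolynomial σ ℝ →ₐ[ℝ] S := rename Sum.inl
  -- If `I` contains no nonzero polynomial in `c` alone, some prime above `I` has the same property;
  -- in its residue field the `c` are algebraically independent and have a degenerate critical
  -- point.
  by_cases hI : Disjoint (I : Set S) ((nonZeroDivisors (MvPolynomial σ ℝ)).map ρ : Submonoid S)
  · exfalso
    obtain ⟨P, hP, hIP, hdisj⟩ := Ideal.exists_le_prime_disjoint I _ hI
    let L := FractionRing (S ⧸ P)
    let f : S →ₐ[ℝ] L :=
      (IsScalarTower.toAlgHom ℝ (S ⧸ P) L).comp (Ideal.Quotient.mkₐ ℝ P)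
    have hf : ∀ s, f s = 0 ↔ s ∈ P := by
      intro s
      change algebraMap (S ⧸ P) L (Ideal.Quotient.mk P s) = 0 ↔ _
      rw [IsFractionRing.to_map_eq_zero_iff, Ideal.Quotient.eq_zero_iff_mem]
    have hc : AlgebraicIndependent ℝ (f ∘ C) := by
      rw [algebraicIndependent_iff]
      intro q hq
      by_contra hq0
      have h1 : f (ρ q) = 0 := by
        rw [← hq, ← AlgHom.comp_apply]
        congr 1
        ext i
        simp only [aeval_X, AlgHom.comp_apply, Function.comp_apply]
        exact congrArg f (rename_X Sum.inl i)
      exact disjoint_left.1 hdisj ((hf _).1 h1)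
        ⟨q, mem_nonZeroDivisors_of_ne_zero hq0, rfl⟩
    refine det_hess_ne_zero_of_algebraicIndependent p hc (x := f ∘ Y) (fun i => ?_) ?_
    · rw [← map_critEq, hf]
      exact hIP (Ideal.subset_span (Or.inl ⟨i, rfl⟩))
    · rw [← map_det_hess, hf]
      exact hIP (Ideal.subset_span (Or.inr rfl))
  · obtain ⟨_, hqI, q, hq, rfl⟩ := not_disjoint_iff.1 hI
    refine ⟨q, nonZeroDivisors.ne_zero hq, fun c x hcx hdet => ?_⟩
    let φ : S →ₐ[ℝ] ℝ := aeval (Sum.elim c x)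
    have hφC : φ ∘ C = c := funext fun i => aeval_X _ _
    have hφY : φ ∘ Y = x := funext fun i => aeval_X _ _
    have hker : I ≤ RingHom.ker φ := by
      refine Ideal.span_le.2 ?_
      rintro _ (⟨i, rfl⟩ | rfl)
      · change φ _ = 0
        rw [map_critEq, hφC, hφY, hcx]
      · change φ _ = 0
        rw [map_det_hess, hφC, hφY, hdet]
    have := hker hqI
    change φ (ρ q) = 0 at this
    rw [← AlgHom.comp_apply] at this
    rw [← this, ← aeval_eq_eval]
    congr 1
    ext i
    rw [aeval_X]
    exact ((congrArg φ (rename_X Sum.inl i)).trans (aeval_X _ _)).symm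

/-- The coordinate ring of the scheme of nondegenerate critical points is unramified over the ring
of coefficients. -/
theorem formallyUnramified_of_isUnit_det_hess {R B : Type*} [CommRing R] [Algebra ℝ R] [CommRing B]
    [Algebra ℝ B] [Algebra R B] [IsScalarTower ℝ R B] (p : MvPolynomial σ ℝ) (c : σ → R)
    (x : σ → B) (y : B) (hgen : Algebra.adjoin R (insert y (range x)) = ⊤)
    (hx : ∀ i, critEq p (algebraMap R B ∘ c) x i = 0)
    (hy : y * (hess p (algebraMap R B ∘ c) x).det = 1) : Algebra.FormallyUnramified R B := by
  let D := KaehlerDifferential.D R B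
  let D' : Derivation ℝ B (Ω[B⁄R]) := D.restrictScalars ℝ
  have hR : ∀ a, D' (algebraMap R B a) = 0 := fun a => D.map_algebraMap a
  have hdet : IsUnit (hess p (algebraMap R B ∘ c) x).det := .of_mul_eq_one_right _ hy
  have hDx : ∀ i, D (x i) = 0 := by
    have h : ∀ i, ∑ j, hess p (algebraMap R B ∘ c) x i j • D (x j) = 0 := by
      intro i
      have := derivation_critEq D' p (algebraMap R B ∘ c) x i
      simpa [hx, hR, D', D] using this.symm
    intro i
    have h2 : ∑ k, (hess p (algebraMap R B ∘ c) x)⁻¹ i k •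
        ∑ j, hess p (algebraMap R B ∘ c) x k j • D (x j) = 0 := by simp [h]
    simp_rw [Finset.smul_sum, smul_smul] at h2
    rw [Finset.sum_comm] at h2
    simp_rw [← Finset.sum_smul, ← Matrix.mul_apply, Matrix.nonsing_inv_mul _ hdet] at h2
    simpa [Matrix.one_apply] using h2
  have hDdet : D (hess p (algebraMap R B ∘ c) x).det = 0 := by
    refine derivation_det_eq_zero D' _ fun i j => ?_
    have h1 : D' (aeval x (pderiv j (pderiv i p))) = 0 := by
      rw [derivation_aeval]
      exact Finset.sum_eq_zero fun k _ => by rw [show D' (x k) = 0 from hDx k, smul_zero]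
    by_cases hij : i = j
    · subst hij; simp [hess, h1, hR]
    · simp [hess, h1, hij]
  have hDy : D y = 0 := by
    have h := congrArg D hy
    rw [D.leibniz, hDdet, smul_zero, zero_add, D.map_one_eq_zero] at h
    exact hdet.smul_eq_zero.1 h
  have hD : D = 0 := by
    refine Derivation.ext_of_adjoin_eq_top _ hgen ?_
    rintro _ (rfl | ⟨i, rfl⟩)
    · exact hDy
    · exact hDx i
  constructor
  rw [← Submodule.subsingleton_iff B, ← subsingleton_iff_bot_eq_top,
    ← KaehlerDifferential.span_range_derivation R B]
  symm
  rw [Submodule.span_eq_bot]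
  rintro _ ⟨b, rfl⟩
  exact congrArg (fun d : Derivation R B (Ω[B⁄R]) => d b) hD

/-- An unramified algebra of finite type over a field is finite-dimensional, so `b` is algebraic
after base change to the fraction field. The relation then holds in `B` up to a nonzero factor `m`
from `R`, which is absorbed into the polynomial. -/
theorem isAlgebraic_of_formallyUnramified {R B : Type*} [CommRing R] [IsDomain R] [CommRing B]
    [Algebra R B] [Algebra.FiniteType R B] [Algebra.FormallyUnramified R B] (b : B) :
    IsAlgebraic R b := by
  let K := FractionRing R
  have := Algebra.FormallyUnramified.finite_of_free K (TensorProduct R K B)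
  obtain ⟨P, hP, h⟩ := (IsFractionRing.isAlgebraic_iff R K (TensorProduct R K B)).2
    (Algebra.IsAlgebraic.isAlgebraic (R := K) (1 ⊗ₜ[R] b : TensorProduct R K B))
  have h' : TensorProduct.mk R K B 1 (Polynomial.aeval b P) = 0 := by
    rw [← h]
    exact (Polynomial.aeval_algHom_apply
      (Algebra.TensorProduct.includeRight : B →ₐ[R] TensorProduct R K B) b P).symm
  obtain ⟨m, hm⟩ := (IsLocalizedModule.eq_zero_iff (nonZeroDivisors R) _).1 h'
  refine ⟨(m : R) • P, ?_, ?_⟩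
  · exact smul_ne_zero (nonZeroDivisors.ne_zero m.2) hP
  · rw [map_smul]; exact hm

/-- Along a polynomial curve of coefficients, the coordinates of the nondegenerate critical points
of `p + ½ ∑ cᵢ xᵢ²` and the reciprocals of their Hessian determinants are algebraic functions. -/
theorem exists_polynomial_nondegenerate (p : MvPolynomial σ ℝ) (c : σ → Polynomial ℝ)
    (j : Option σ) :
    ∃ P : Polynomial (Polynomial ℝ), P ≠ 0 ∧ ∀ (t : ℝ) (x : σ → ℝ),
      (∀ i, critEq p (fun k => (c k).eval t) x i = 0) →
      (hess p (fun k => (c k).eval t) x).det ≠ 0 →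
      (P.map (Polynomial.evalRingHom t)).eval
        (j.elim (hess p (fun k => (c k).eval t) x).det⁻¹ x) = 0 := by
  -- The extra variable `none` is the inverse of the Hessian determinant.
  let S := MvPolynomial (Option σ) (Polynomial ℝ)
  let c' : σ → S := fun i => C (c i)
  let Y : σ → S := fun i => X (some i)
  let I : Ideal S := Ideal.span (range (critEq p c' Y) ∪ {X none * (hess p c' Y).det - 1})
  let mk := Ideal.Quotient.mkₐ ℝ I
  have hmk : ∀ s ∈ I, mk s = 0 := fun s hs => Ideal.Quotient.eq_zero_iff_mem.2 hs
  have hc' : mk ∘ c' = algebraMap (Polynomial ℝ) (S ⧸ I) ∘ c := rfl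
  have : Algebra.FormallyUnramified (Polynomial ℝ) (S ⧸ I) := by
    refine formallyUnramified_of_isUnit_det_hess p c (mk ∘ Y) (mk (X none)) ?_ (fun i => ?_) ?_
    · let q : S →ₐ[Polynomial ℝ] S ⧸ I := Ideal.Quotient.mkₐ _ I
      have h1 : insert (mk (X none)) (range (mk ∘ Y)) = q '' range (X : Option σ → S) := by
        ext z
        constructor
        · rintro (rfl | ⟨i, rfl⟩)
          · exact ⟨_, ⟨none, rfl⟩, rfl⟩
          · exact ⟨_, ⟨some i, rfl⟩, rfl⟩
        · rintro ⟨_, ⟨_ | i, rfl⟩, rfl⟩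
          · exact Or.inl rfl
          · exact Or.inr ⟨i, rfl⟩
      rw [h1, ← AlgHom.map_adjoin, adjoin_range_X, Algebra.map_top, AlgHom.range_eq_top]
      exact Ideal.Quotient.mkₐ_surjective _ _
    · rw [← hc', ← map_critEq]
      exact hmk _ (Ideal.subset_span (Or.inl ⟨i, rfl⟩))
    · rw [← hc', ← map_det_hess, ← map_mul, ← sub_eq_zero, ← map_one mk, ← map_sub]
      exact hmk _ (Ideal.subset_span (Or.inr rfl))
  have : Algebra.FiniteType (Polynomial ℝ) (S ⧸ I) :=
    .of_surjective (Ideal.Quotient.mkₐ (Polynomial ℝ) I) (Ideal.Quotient.mkₐ_surjective _ _)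
  obtain ⟨P, hP, h⟩ := isAlgebraic_of_formallyUnramified (R := Polynomial ℝ)
    (Ideal.Quotient.mk I (X j))
  have hPI : Polynomial.aeval (X j : S) P ∈ I := by
    rw [← Ideal.Quotient.eq_zero_iff_mem, ← h]
    exact (Polynomial.aeval_algHom_apply (Ideal.Quotient.mkₐ (Polynomial ℝ) I) (X j) P).symm
  refine ⟨P, hP, fun t x hx hdet => ?_⟩
  let v : Option σ → ℝ := fun j => j.elim (hess p (fun k => (c k).eval t) x).det⁻¹ x
  let φ : S →+* ℝ := eval₂Hom (Polynomial.evalRingHom t) v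
  have hφC : ∀ r : Polynomial ℝ, φ (C r) = r.eval t := fun r => eval₂_C _ _ _
  let φ' : S →ₐ[ℝ] ℝ := AlgHom.mk φ fun r => (hφC _).trans Polynomial.eval_C
  have hφX : ∀ j, φ (X j) = v j := fun j => eval₂_X _ _ _
  have hφc : φ' ∘ c' = fun k => (c k).eval t := funext fun k => hφC _
  have hφY : φ' ∘ Y = x := funext fun i => hφX (some i)
  have hker : I ≤ RingHom.ker φ := by
    refine Ideal.span_le.2 ?_
    rintro _ (⟨i, rfl⟩ | rfl)
    · change φ' _ = 0
      rw [map_critEq, hφc, hφY, hx]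
    · change φ' _ = 0
      rw [map_sub, map_mul, map_det_hess, hφc, hφY, map_one, show φ' (X none) = v none from hφX none]
      simp [v, hdet]
  have h0 : φ (Polynomial.aeval (X j : S) P) = 0 := hker hPI
  rw [Polynomial.aeval_def, Polynomial.hom_eval₂, hφX] at h0
  rw [Polynomial.eval_map, ← h0]
  congr 1
  exact RingHom.ext fun r => (hφC r).symm

end

/-! ### Splitting a transverse zero set into smooth graphs. -/

section Sections
variable {E : Type*} [NormedAddCommGroup E] [NormedSpace ℝ E] [FiniteDimensional ℝ E]

/-- The implicit function theorem: near a point where the partial derivative in the second variable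
is injective, the zero set is the graph of a smooth function of the first variable. -/
lemma exists_local_section {F : ℝ × E → E} (hF : ContDiff ℝ ∞ F) {z : ℝ × E} (hz : F z = 0)
    (hinj : ∀ v, fderiv ℝ F z (0, v) = 0 → v = 0) :
    ∃ s : ℝ → E, ContDiffAt ℝ ∞ s z.1 ∧ s z.1 = z.2 ∧ (∀ᶠ t in 𝓝 z.1, F (t, s t) = 0) ∧
      ∀ᶠ w in 𝓝 z, F w = 0 → w.2 = s w.1 := by
  have : CompleteSpace E := FiniteDimensional.complete ℝ E
  let Φ : ℝ × E → ℝ × E := fun w => (w.1, F w)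
  have hΦ : ContDiff ℝ ∞ Φ := contDiff_fst.prodMk hF
  let A : ℝ × E →L[ℝ] ℝ × E := (ContinuousLinearMap.fst ℝ ℝ E).prod (fderiv ℝ F z)
  have hA : Function.Injective A := by
    rw [injective_iff_map_eq_zero]
    rintro ⟨τ, v⟩ h
    have h1 : τ = 0 := congrArg Prod.fst h
    subst h1
    have h2 : fderiv ℝ F z (0, v) = 0 := congrArg Prod.snd h
    rw [hinj v h2]
    rfl
  let A' : (ℝ × E) ≃L[ℝ] ℝ × E :=
    (LinearEquiv.ofInjectiveEndo (A : ℝ × E →ₗ[ℝ] ℝ × E) hA).toContinuousLinearEquiv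
  have hΦ' : HasFDerivAt Φ (A' : ℝ × E →L[ℝ] ℝ × E) z := by
    have : (A' : ℝ × E →L[ℝ] ℝ × E) = A := by ext <;> rfl
    rw [this]
    exact hasFDerivAt_fst.prodMk (hF.differentiable (by simp) z).hasFDerivAt
  let φ := hΦ.contDiffAt.toOpenPartialHomeomorph Φ hΦ' (by simp)
  have hφ : ∀ w, φ w = (w.1, F w) := fun _ => rfl
  have hzs : z ∈ φ.source := hΦ.contDiffAt.mem_toOpenPartialHomeomorph_source hΦ' (by simp)
  have hΦz : (z.1, (0 : E)) = φ z := by rw [hφ, hz]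
  have hzt : (z.1, (0 : E)) ∈ φ.target := hΦz ▸ φ.map_source hzs
  have hsymm : ContDiffAt ℝ ∞ φ.symm (z.1, (0 : E)) := by
    rw [hΦz]
    exact hΦ.contDiffAt.to_localInverse hΦ' (by simp)
  have hcont : ContinuousAt (fun t : ℝ => (t, (0 : E))) z.1 := by fun_prop
  refine ⟨fun t => (φ.symm (t, 0)).2, ?_, ?_, ?_, ?_⟩
  · exact contDiffAt_snd.comp z.1 (hsymm.comp z.1 (contDiffAt_id.prodMk contDiffAt_const))
  · change (φ.symm (z.1, 0)).2 = z.2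
    rw [hΦz, φ.left_inv hzs]
  · filter_upwards [hcont.eventually (φ.open_target.mem_nhds hzt)] with t ht
    have h := φ.right_inv ht
    rw [hφ] at h
    have h1 := congrArg Prod.fst h
    have h2 := congrArg Prod.snd h
    simp only at h1 h2
    refine Eq.trans (congrArg F ?_) h2
    exact Prod.ext h1.symm rfl
  · filter_upwards [φ.open_source.mem_nhds hzs] with w hw h0
    have := φ.left_inv hw
    rw [hφ, h0] at this
    exact (congrArg Prod.snd this).symm

/-- A bounded zero set that is transverse to the fibres over an interval is a finite union of
disjoint smooth graphs. -/
theorem exists_smooth_sections {F : ℝ × E → E} (hF : ContDiff ℝ ∞ F) {ε : ℝ} (hε : 0 < ε)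
    {Z : Set (ℝ × E)} (hZI : ∀ z ∈ Z, z.1 ∈ Ioo 0 ε) (hZ0 : ∀ z ∈ Z, F z = 0)
    (hZn : ∀ z ∈ Z, ∀ᶠ w in 𝓝 z, F w = 0 → w ∈ Z)
    (hinj : ∀ z ∈ Z, ∀ v, fderiv ℝ F z (0, v) = 0 → v = 0)
    (hcpt : ∀ a b, 0 < a → b < ε → IsCompact (Z ∩ Icc a b ×ˢ univ)) :
    ∃ (N : ℕ) (γ : Fin N → ℝ → E), (∀ p, ContDiffOn ℝ ∞ (γ p) (Ioo 0 ε)) ∧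
      ∀ t ∈ Ioo 0 ε, Function.Injective (fun p => γ p t) ∧
        {x | (t, x) ∈ Z} = range (fun p => γ p t) := by
  have hloc : ∀ z ∈ Z, ∃ s : ℝ → E, ContDiffAt ℝ ∞ s z.1 ∧ s z.1 = z.2 ∧
      (∀ᶠ t in 𝓝 z.1, (t, s t) ∈ Z) ∧ ∀ᶠ w in 𝓝 z, w ∈ Z → w.2 = s w.1 := by
    intro z hz
    obtain ⟨s, hs, hsz, h1, h2⟩ := exists_local_section hF (hZ0 z hz) (hinj z hz)
    refine ⟨s, hs, hsz, ?_, h2.mono fun w h hw => h (hZ0 w hw)⟩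
    have hc : Tendsto (fun t => (t, s t)) (𝓝 z.1) (𝓝 z) := by
      have : ContinuousAt (fun t => (t, s t)) z.1 := continuousAt_id.prodMk hs.continuousAt
      simpa [ContinuousAt, hsz] using this
    filter_upwards [h1, hc.eventually (hZn z hz)] with t h h' using h' h
  let π : Z → Ioo 0 ε := fun z => ⟨z.1.1, hZI z.1 z.2⟩
  have hπ : Continuous π := by fun_prop
  have hopen : IsOpenMap π := by
    rw [isOpenMap_iff_nhds_le]
    intro z U hU
    obtain ⟨s, hs, hsz, h1, -⟩ := hloc z.1 z.2
    obtain ⟨V, hV, hVU⟩ := mem_nhds_subtype _ _ _ |>.1 (mem_map.1 hU)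
    have hc : Tendsto (fun t => (t, s t)) (𝓝 z.1.1) (𝓝 z.1) := by
      have : ContinuousAt (fun t => (t, s t)) z.1.1 := continuousAt_id.prodMk hs.continuousAt
      simpa [ContinuousAt, hsz] using this
    rw [mem_nhds_subtype]
    refine ⟨_, h1.and (hc.eventually hV), ?_⟩
    rintro ⟨t, ht⟩ ⟨htZ, htV⟩
    exact hVU (a := ⟨(t, s t), htZ⟩) htV
  have hlh : IsLocalHomeomorph π := by
    rw [isLocalHomeomorph_iff_isOpenEmbedding_restrict]
    intro z
    obtain ⟨s, hs, hsz, -, h2⟩ := hloc z.1 z.2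
    obtain ⟨V, hVs, hV, hzV⟩ := eventually_nhds_iff.1 h2
    refine ⟨Subtype.val ⁻¹' V, (hV.preimage continuous_subtype_val).mem_nhds hzV, ?_⟩
    refine .of_continuous_injective_isOpenMap (hπ.comp continuous_subtype_val) ?_
      (hopen.comp (hV.preimage continuous_subtype_val).isOpenMap_subtype_val)
    rintro ⟨⟨w, hw⟩, hwV⟩ ⟨⟨w', hw'⟩, hwV'⟩ h
    have h1 : w.1 = w'.1 := congrArg Subtype.val h
    have h2 : w.2 = w'.2 := by rw [hVs w hwV hw, hVs w' hwV' hw', h1]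
    simp only [Subtype.mk.injEq]
    exact Prod.ext h1 h2
  have : LocallyCompactSpace (Ioo (0 : ℝ) ε) := isOpen_Ioo.locallyCompactSpace
  -- A proper local homeomorphism has finite fibres and is a covering; the interval is simply
  -- connected, so the covering is trivial.
  have hproper : IsProperMap π := by
    rw [isProperMap_iff_isCompact_preimage]
    refine ⟨hπ, fun {K} hK => ?_⟩
    have hK' : IsCompact (Subtype.val '' K) := hK.image continuous_subtype_val
    rw [Subtype.isCompact_iff]
    rcases K.eq_empty_or_nonempty with rfl | hne
    · simp
    obtain ⟨⟨a, ha⟩, haK, hamin⟩ := hK.exists_isMinOn hne continuous_id.continuousOn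
    obtain ⟨⟨b, hb⟩, hbK, hbmax⟩ := hK.exists_isMaxOn hne continuous_id.continuousOn
    have : Subtype.val '' (π ⁻¹' K) =
        (Z ∩ Icc a b ×ˢ univ) ∩ (Prod.fst ⁻¹' (Subtype.val '' K)) := by
      ext z
      constructor
      · rintro ⟨z, hz, rfl⟩
        exact ⟨⟨z.2, ⟨hamin hz, hbmax hz⟩, trivial⟩, ⟨_, hz, rfl⟩⟩
      · rintro ⟨⟨hz, -⟩, t, ht, htz⟩
        refine ⟨⟨z, hz⟩, ?_, rfl⟩
        rw [mem_preimage]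
        convert ht
        exact Subtype.ext htz.symm
    rw [this]
    exact (hcpt a b ha.1 hb.2).inter_right (hK'.isClosed.preimage continuous_fst)
  have hcov : IsCoveringMap π := by
    rw [isCoveringMap_iff_isCoveringMapOn_univ]
    refine hproper.isClosedMap.isCoveringMapOn_of_isLocalHomeomorphOn (fun t _ => ?_)
      (isLocalHomeomorph_iff_isLocalHomeomorphOn_univ.1 hlh |>.mono (subset_univ _))
    exact (hproper.isCompact_preimage isCompact_singleton).finite
      (.of_openPartialHomeomorph π subset_rfl fun e _ => by
        obtain ⟨φ, hφ, h⟩ := hlh e; exact ⟨φ, hφ, h.symm⟩)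
  let t₀ : Ioo (0 : ℝ) ε := ⟨ε / 2, by constructor <;> linarith⟩
  have hfin : Finite (π ⁻¹' {t₀}) := (hproper.isCompact_preimage isCompact_singleton).finite
      (.of_openPartialHomeomorph π subset_rfl fun e _ => by
        obtain ⟨φ, hφ, h⟩ := hlh e; exact ⟨φ, hφ, h.symm⟩)
  have : ContractibleSpace (Ioo (0 : ℝ) ε) := (convex_Ioo 0 ε).contractibleSpace ⟨t₀.1, t₀.2⟩
  have : LocallyPathConnectedSpace (Ioo (0 : ℝ) ε) := isOpen_Ioo.locallyPathConnectedSpace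
  have : PreconnectedSpace (Ioo (0 : ℝ) ε) := inferInstance
  let e := (Finite.equivFin (π ⁻¹' {t₀})).symm
  -- One section through each point of the fibre over the midpoint. Uniqueness of lifts makes the
  -- sections disjoint and, by lifting from any other point, exhaustive.
  choose Γ hΓ hΓu using fun p => hcov.existsUnique_continuousMap_lifts
    (ContinuousMap.id (Ioo (0 : ℝ) ε)) t₀ (e p).1 (e p).2
  have hΓπ : ∀ p t, π (Γ p t) = t := fun p t => congrFun (hΓ p).2 t
  classical
  let γ : Fin (Nat.card (π ⁻¹' {t₀})) → ℝ → E :=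
    fun p t => if h : t ∈ Ioo 0 ε then (Γ p ⟨t, h⟩).1.2 else 0
  have hγ : ∀ p t (h : t ∈ Ioo 0 ε), (Γ p ⟨t, h⟩).1 = (t, γ p t) := by
    intro p t h
    refine Prod.ext (congrArg Subtype.val (hΓπ p ⟨t, h⟩)) ?_
    simp only [γ, dif_pos h]
  refine ⟨_, γ, fun p t ht => ?_, fun t ht => ⟨fun p q hpq => ?_, ?_⟩⟩
  · obtain ⟨s, hs, -, -, h2⟩ := hloc _ (Γ p ⟨t, ht⟩).2
    rw [hγ] at hs h2
    refine (hs.congr_of_eventuallyEq ?_).contDiffWithinAt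
    have hc : Tendsto (fun u => (Γ p u).1) (𝓝 ⟨t, ht⟩) (𝓝 (t, γ p t)) := by
      rw [← hγ p t ht]
      exact (continuous_subtype_val.comp (Γ p).continuous).continuousAt
    have h3 := hc.eventually h2
    rw [← map_nhds_subtype_coe_eq_nhds ht (isOpen_Ioo.mem_nhds ht)]
    rw [EventuallyEq, eventually_map]
    filter_upwards [h3] with u hu
    have := hu (Γ p u).2
    rwa [hγ p u.1 u.2] at this
  · have h1 : Γ p ⟨t, ht⟩ = Γ q ⟨t, ht⟩ := by
      apply Subtype.ext
      rw [hγ, hγ]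
      exact congrArg (Prod.mk t) hpq
    have h2 := hcov.eq_of_comp_eq (Γ p).continuous (Γ q).continuous
      ((hΓ p).2.trans (hΓ q).2.symm) ⟨t, ht⟩ h1
    have h3 := congrFun h2 t₀
    rw [(hΓ p).1, (hΓ q).1] at h3
    exact e.injective (Subtype.ext h3)
  · ext x
    constructor
    · intro hx
      obtain ⟨G, ⟨hG, hGπ⟩, -⟩ := hcov.existsUnique_continuousMap_lifts
        (ContinuousMap.id (Ioo (0 : ℝ) ε)) ⟨t, ht⟩ ⟨(t, x), hx⟩ rfl
      let f : π ⁻¹' {t₀} := ⟨G t₀, congrFun hGπ t₀⟩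
      have h1 : G = Γ (e.symm f) := hΓu _ G ⟨by rw [e.apply_symm_apply], hGπ⟩
      refine ⟨e.symm f, ?_⟩
      have h2 := hγ (e.symm f) t ht
      rw [← h1, hG] at h2
      exact (congrArg Prod.snd h2).symm
    · rintro ⟨p, rfl⟩
      change (t, γ p t) ∈ Z
      rw [← hγ p t ht]
      exact (Γ p ⟨t, ht⟩).2

end Sections

/-! ### Zero sets of polynomials are null. -/

section NullSets

/-- Fubini and induction: only finitely many values of coordinate `0` specialize `q` to the zero
polynomial, and every other slice is null. -/
lemma volume_zeros_fin (n : ℕ) (q : MvPolynomial (Fin n) ℝ) (hq : q ≠ 0) :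
    volume {x : Fin n → ℝ | eval x q = 0} = 0 := by
  induction n with
  | zero =>
    obtain ⟨r, rfl⟩ := C_surjective (Fin 0) q
    have hr : r ≠ 0 := fun h => hq (by simp [h])
    simp [hr]
  | succ n ih =>
    let e := MeasurableEquiv.piFinSuccAbove (fun _ : Fin (n + 1) => ℝ) 0
    have he : MeasurePreserving e :=
      volume_preserving_piFinSuccAbove (fun _ : Fin (n + 1) => ℝ) 0
    let S : Set (ℝ × (Fin n → ℝ)) := {z | eval (Fin.cons z.1 z.2 : Fin (n + 1) → ℝ) q = 0}
    have hS : IsClosed S := by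
      have hc : Continuous fun z : ℝ × (Fin n → ℝ) => (Fin.cons z.1 z.2 : Fin (n + 1) → ℝ) :=
        continuous_pi fun i => by
          refine Fin.cases ?_ (fun j => ?_) i
          · exact continuous_fst
          · exact (continuous_apply j).comp continuous_snd
      exact isClosed_eq ((continuous_eval q).comp hc) continuous_const
    have hpre : {x : Fin (n + 1) → ℝ | eval x q = 0} = e ⁻¹' S := by
      ext x
      have : (Fin.cons (e x).1 (e x).2 : Fin (n + 1) → ℝ) = x := Fin.cons_self_tail x
      simp only [mem_ofPred_eq, mem_preimage, S, this]
    rw [hpre, he.measure_preimage hS.measurableSet.nullMeasurableSet, Measure.volume_eq_prod,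
      Measure.measure_prod_null hS.measurableSet]
    let Q := finSuccEquiv ℝ n q
    have hQ : Q ≠ 0 := (map_ne_zero_iff _ (finSuccEquiv ℝ n).injective).2 hq
    have hfin : {a : ℝ | Q.eval (C a) = 0}.Finite := by
      have : {a : ℝ | Q.eval (C a) = 0} = C ⁻¹' {b | Q.IsRoot b} := rfl
      rw [this]
      exact (Polynomial.finite_setOfPred_isRoot hQ).preimage (C_injective _ _).injOn
    have hae : ∀ᵐ a : ℝ, Q.eval (C a) ≠ 0 := by
      rw [ae_iff]
      simpa using hfin.measure_zero volume
    filter_upwards [hae] with a ha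
    rw [Pi.zero_apply, ← ih _ ha]
    congr 1
    ext y
    simp only [S, mem_preimage, mem_ofPred_eq, eval_eq_eval_mv_eval']
    have h := Polynomial.eval₂_at_apply (p := Q) (eval y) (C a)
    rw [eval_C] at h
    rw [Polynomial.eval_map, h]

/-- The zero set of a nonzero polynomial function on a finite-dimensional space is a null set. -/
theorem ae_eval_ne_zero {σ E : Type*} [Fintype σ] [NormedAddCommGroup E] [NormedSpace ℝ E]
    [MeasurableSpace E] [BorelSpace E] (μ : Measure E) [μ.IsAddHaarMeasure] (e : E ≃L[ℝ] (σ → ℝ))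
    {q : MvPolynomial σ ℝ} (hq : q ≠ 0) : ∀ᵐ w ∂μ, eval (e w) q ≠ 0 := by
  let f := Fintype.equivFin σ
  let e' : E ≃L[ℝ] (Fin (Fintype.card σ) → ℝ) :=
    e.trans (LinearEquiv.funCongrLeft ℝ ℝ f.symm).toContinuousLinearEquiv
  have h := volume_zeros_fin _ (rename f q) ((map_ne_zero_iff _ (rename_injective _ f.injective)).2 hq)
  have hac : μ.map e' ≪ volume := Measure.absolutelyContinuous_isAddHaarMeasure _ _
  have h1 : ∀ᵐ x ∂(μ.map e'), eval x (rename f q) ≠ 0 := by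
    rw [ae_iff]
    simpa using hac h
  have h2 := ae_of_ae_map e'.continuous.aemeasurable h1
  filter_upwards [h2] with w hw
  rw [eval_rename] at hw
  convert hw
  ext i
  simp [e', LinearEquiv.funCongrLeft_apply, LinearMap.funLeft]

end NullSets

/-! ### Algebraic functions of one real variable. -/

section AlgebraicFunctions
open Polynomial (evalRingHom)

lemma eventually_eval_ne_zero {q : Polynomial ℝ} (hq : q ≠ 0) :
    ∀ᶠ t in 𝓝[>] (0 : ℝ), q.eval t ≠ 0 := by
  have h := (Polynomial.finite_setOfPred_isRoot hq)
  have h1 : ({t | q.IsRoot t} \ {0})ᶜ ∈ 𝓝 (0 : ℝ) :=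
    (h.subset sdiff_subset).isClosed.isOpen_compl.mem_nhds (by simp)
  filter_upwards [nhdsWithin_le_nhds h1, self_mem_nhdsWithin] with t ht ht0 h0
  exact ht ⟨h0, (ne_of_gt ht0 : t ≠ 0)⟩

/-- A continuous algebraic function of one real variable has a finite or infinite limit. -/
theorem tendsto_of_algebraic {P : Polynomial (Polynomial ℝ)} (hP : P ≠ 0) {ε : ℝ} (hε : 0 < ε)
    {g : ℝ → ℝ} (hg : ContinuousOn g (Ioo 0 ε))
    (h : ∀ t ∈ Ioo 0 ε, (P.map (evalRingHom t)).eval (g t) = 0) :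
    (∃ l, Tendsto g (𝓝[>] 0) (𝓝 l)) ∨ Tendsto (fun t => |g t|) (𝓝[>] 0) atTop := by
  -- The levels `a` with `P(t, a)` identically zero in `t`. For `a ∉ B`, `g` avoids `a` near `0`, so
  -- by the intermediate value theorem it stays on one side.
  let B : Set ℝ := {a | P.eval (Polynomial.C a) = 0}
  have hB : B.Finite := by
    have : B = Polynomial.C ⁻¹' {b | P.IsRoot b} := rfl
    rw [this]
    exact (Polynomial.finite_setOfPred_isRoot hP).preimage Polynomial.C_injective.injOn
  have hdich : ∀ a ∉ B, (∀ᶠ t in 𝓝[>] 0, g t < a) ∨ ∀ᶠ t in 𝓝[>] 0, a < g t := by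
    intro a ha
    have h1 := eventually_eval_ne_zero (q := P.eval (Polynomial.C a)) ha
    rw [eventually_nhdsWithin_iff] at h1
    obtain ⟨δ, hδ, hball⟩ := Metric.eventually_nhds_iff.1 h1
    have hne : ∀ t ∈ Ioo 0 (min ε δ), g t ≠ a := by
      intro t ht hgt
      refine hball (y := t) ?_ ht.1 ?_
      · rw [Real.dist_eq, sub_zero, abs_of_pos ht.1]
        exact ht.2.trans_le (min_le_right _ _)
      · have := h t ⟨ht.1, ht.2.trans_le (min_le_left _ _)⟩
        rw [hgt, Polynomial.eval_map] at this
        rw [← this, ← Polynomial.coe_evalRingHom, Polynomial.eval, Polynomial.hom_eval₂]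
        simp
    have hI : Ioo 0 (min ε δ) ∈ 𝓝[>] (0 : ℝ) := Ioo_mem_nhdsGT (lt_min hε hδ)
    have hpre : IsPreconnected (g '' Ioo 0 (min ε δ)) :=
      isPreconnected_Ioo.image _ (hg.mono (Ioo_subset_Ioo_right (min_le_left _ _)))
    by_contra hcon
    rw [not_or, not_eventually, not_eventually] at hcon
    obtain ⟨hc1, hc2⟩ := hcon
    obtain ⟨t, ht1, ht⟩ := (hc1.and_eventually hI).exists
    obtain ⟨u, hu1, hu⟩ := (hc2.and_eventually hI).exists
    obtain ⟨w, hw, hwa⟩ := hpre.Icc_subset ⟨u, hu, rfl⟩ ⟨t, ht, rfl⟩ ⟨not_lt.1 hu1, not_lt.1 ht1⟩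
    exact hne w hw hwa
  have hinf : ∀ M, (∃ a ∉ B, M < a) ∧ ∃ a ∉ B, a < M := by
    intro M
    constructor
    · obtain ⟨a, ha, haB⟩ := ((Ioi_infinite M).sdiff hB).nonempty
      exact ⟨a, haB, ha⟩
    · obtain ⟨a, ha, haB⟩ := ((Iio_infinite M).sdiff hB).nonempty
      exact ⟨a, haB, ha⟩
  by_cases htop : ∀ a ∉ B, ∀ᶠ t in 𝓝[>] 0, a < g t
  · right
    refine tendsto_abs_atTop_atTop.comp (tendsto_atTop.2 fun M => ?_)
    obtain ⟨a, ha, haM⟩ := (hinf M).1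
    exact (htop a ha).mono fun t ht => (haM.trans ht).le
  by_cases hbot : ∀ a ∉ B, ∀ᶠ t in 𝓝[>] 0, g t < a
  · right
    refine tendsto_abs_atBot_atTop.comp (tendsto_atBot.2 fun M => ?_)
    obtain ⟨a, ha, haM⟩ := (hinf M).2
    exact (hbot a ha).mono fun t ht => (ht.trans haM).le
  left
  simp only [not_forall] at htop hbot
  obtain ⟨a, ha, hanot⟩ := htop
  obtain ⟨b, hb, hbnot⟩ := hbot
  have h1 := (hdich a ha).resolve_right hanot
  have h2 := (hdich b hb).resolve_left hbnot
  refine tendsto_of_no_upcrossings (s := Bᶜ) (hB.countable.dense_compl ℝ) ?_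
    ⟨a, h1.mono fun t ht => ht.le⟩ ⟨b, h2.mono fun t ht => ht.le⟩
  rintro c hc d - hcd ⟨hf1, hf2⟩
  rcases hdich c hc with h3 | h3
  · obtain ⟨t, ht1, ht2⟩ := (hf2.and_eventually h3).exists
    linarith
  · obtain ⟨t, ht1, ht2⟩ := (hf1.and_eventually h3).exists
    linarith

/-- The roots of a polynomial whose coefficients depend on a parameter are bounded, uniformly
for parameters in a compact set on which the leading coefficient does not vanish. -/
lemma exists_bound_roots {P : Polynomial (Polynomial ℝ)} {K : Set ℝ} (hK : IsCompact K)
    (hlead : ∀ t ∈ K, P.leadingCoeff.eval t ≠ 0) :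
    ∃ M, ∀ t ∈ K, ∀ x, (P.map (evalRingHom t)).eval x = 0 → |x| ≤ M := by
  -- This is Cauchy's root bound, written so that its continuity in `t` is visible.
  have hc : ContinuousOn (fun t => ((Finset.range P.natDegree).sup
      (fun i => ‖(P.coeff i).eval t‖₊) / ‖P.leadingCoeff.eval t‖₊ + 1 : NNReal)) K := by
    refine ContinuousOn.add (ContinuousOn.div ?_ ?_ ?_) continuousOn_const
    · exact (Continuous.finset_sup_apply fun i _ => (P.coeff i).continuous.nnnorm).continuousOn
    · exact P.leadingCoeff.continuous.nnnorm.continuousOn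
    · intro t ht; simpa using hlead t ht
  obtain ⟨M, hM⟩ := (hK.image_of_continuousOn hc).bddAbove
  refine ⟨M, fun t ht x hx => ?_⟩
  have hl : evalRingHom t P.leadingCoeff ≠ 0 := hlead t ht
  have hne : P.map (evalRingHom t) ≠ 0 := by
    intro h0
    have := Polynomial.leadingCoeff_map_of_leadingCoeff_ne_zero (evalRingHom t) hl
    rw [h0, Polynomial.leadingCoeff_zero] at this
    exact hl this.symm
  have h1 := Polynomial.IsRoot.norm_lt_cauchyBound hne (show (P.map (evalRingHom t)).IsRoot x from hx)
  rw [Polynomial.cauchyBound, Polynomial.leadingCoeff_map_of_leadingCoeff_ne_zero _ hl,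
    Polynomial.natDegree_map_of_leadingCoeff_ne_zero _ hl] at h1
  simp only [Polynomial.coeff_map, Polynomial.coe_evalRingHom] at h1
  have h2 := hM ⟨t, ht, rfl⟩
  exact h1.le.trans (NNReal.coe_le_coe.2 h2)

end AlgebraicFunctions

/-! ### Fréchet derivatives in terms of `critEq` and `hess`. -/

section Calculus
variable {σ : Type*} [Fintype σ] [DecidableEq σ] {E : Type*} [NormedAddCommGroup E]
  [NormedSpace ℝ E] (e : E ≃L[ℝ] (σ → ℝ)) (p : MvPolynomial σ ℝ) (c : σ → ℝ)

/-- The linear forms on `E` given by the coordinates `e`. -/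
noncomputable def coord {σ : Type*} [Fintype σ] {E : Type*} [NormedAddCommGroup E]
    [NormedSpace ℝ E] (e : E ≃L[ℝ] (σ → ℝ)) (i : σ) : E →L[ℝ] ℝ :=
  (ContinuousLinearMap.proj i).comp (e : E →L[ℝ] (σ → ℝ))

lemma hasFDerivAt_aeval {σ : Type*} [Fintype σ] {E : Type*} [NormedAddCommGroup E]
    [NormedSpace ℝ E] (e : E ≃L[ℝ] (σ → ℝ)) (q : MvPolynomial σ ℝ) (w : E) :
    HasFDerivAt (fun w => aeval (e w) q) (∑ j, aeval (e w) (pderiv j q) • coord e j) w := by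
  have hX : ∀ i, HasFDerivAt (fun w => e w i) (coord e i) w := fun i => (coord e i).hasFDerivAt
  induction q using MvPolynomial.induction_on with
  | C a => simpa using hasFDerivAt_const a w
  | add p q hp hq => simpa [add_smul, Finset.sum_add_distrib] using hp.fun_add hq
  | mul_X p i hp =>
    classical
    simp only [map_mul, aeval_X]
    refine (hp.mul (hX i)).congr_fderiv ?_
    simp only [Derivation.leibniz, pderiv_X, smul_eq_mul, map_add, map_mul, add_smul, aeval_X,
      Finset.sum_add_distrib, Finset.smul_sum, smul_smul]
    congr 1
    rw [Finset.sum_eq_single i]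
    · simp
    · intro j _ hj; simp [hj.symm]
    · simp

lemma hasFDerivAt_critEq (i : σ) (w : E) :
    HasFDerivAt (fun w => critEq p c (e w) i) (∑ j, hess p c (e w) i j • coord e j) w := by
  have hX : HasFDerivAt (fun w => e w i) (coord e i) w := (coord e i).hasFDerivAt
  refine ((hasFDerivAt_aeval e (pderiv i p) w).add (hX.const_mul (c i))).congr_fderiv ?_
  simp only [hess, Matrix.add_apply, Matrix.of_apply, add_smul, Finset.sum_add_distrib]
  congr 1
  rw [Finset.sum_eq_single i]
  · simp
  · intro j _ hj; simp [hj.symm]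
  · simp

/-- The function `p + ½ ∑ cᵢ xᵢ²` in the coordinates `e`. -/
noncomputable def regPoly {σ : Type*} [Fintype σ] {E : Type*} [NormedAddCommGroup E]
    [NormedSpace ℝ E] (e : E ≃L[ℝ] (σ → ℝ)) (p : MvPolynomial σ ℝ) (c : σ → ℝ) (w : E) : ℝ :=
  aeval (e w) p + (1 / 2) * ∑ i, c i * e w i ^ 2

lemma fderiv_regPoly {σ : Type*} [Fintype σ] {E : Type*} [NormedAddCommGroup E]
    [NormedSpace ℝ E] (e : E ≃L[ℝ] (σ → ℝ)) (p : MvPolynomial σ ℝ) (c : σ → ℝ) :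
    fderiv ℝ (regPoly e p c) =
    fun w => ∑ i, critEq p c (e w) i • coord e i := by
  ext1 w
  have hX : ∀ i, HasFDerivAt (fun w => e w i) (coord e i) w := fun i => (coord e i).hasFDerivAt
  have h := (hasFDerivAt_aeval e p w).add ((HasFDerivAt.fun_sum (u := Finset.univ) fun i _ =>
    ((hX i).pow 2).const_mul (c i)).const_mul (1 / 2 : ℝ))
  refine (h.congr_fderiv ?_).fderiv
  simp only [critEq, add_smul, Finset.sum_add_distrib, Finset.smul_sum, smul_smul]
  congr 1
  refine Finset.sum_congr rfl fun i _ => ?_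
  congr 1
  push_cast
  ring

lemma sum_smul_coord_eq_zero {a : σ → ℝ} : ∑ i, a i • coord e i = 0 ↔ ∀ i, a i = 0 := by
  constructor
  · intro h i
    have := congrArg (fun f : E →L[ℝ] ℝ => f (e.symm (Pi.single i 1))) h
    simpa [coord, Pi.single_apply] using this
  · intro h; simp [h]

lemma isCritical_regPoly (w : E) :
    IsCritical (regPoly e p c) w ↔ ∀ i, critEq p c (e w) i = 0 := by
  rw [IsCritical, fderiv_regPoly, sum_smul_coord_eq_zero]

lemma isNondegenerateCritical_regPoly (w : E) : IsNondegenerateCritical (regPoly e p c) w ↔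
    (∀ i, critEq p c (e w) i = 0) ∧ (hess p c (e w)).det ≠ 0 := by
  rw [IsNondegenerateCritical, isCritical_regPoly]
  refine and_congr_right fun _ => ?_
  have h2 : ∀ v, fderiv ℝ (fderiv ℝ (regPoly e p c)) w v =
      ∑ i, (Matrix.mulVec (hess p c (e w)) (e v)) i • coord e i := by
    intro v
    rw [fderiv_regPoly]
    have h := HasFDerivAt.fun_sum (u := Finset.univ) fun i _ =>
      (hasFDerivAt_critEq e p c i w).smul_const (coord e i)
    rw [h.fderiv]
    simp [Matrix.mulVec, dotProduct, coord]
  simp_rw [h2, sum_smul_coord_eq_zero]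
  rw [← not_iff_not, not_not, ← Matrix.exists_mulVec_eq_zero_iff]
  push Not
  constructor
  · rintro ⟨v, hv, hv0⟩
    exact ⟨e v, by simpa using hv0, funext hv⟩
  · rintro ⟨v, hv, hv0⟩
    exact ⟨e.symm v, fun i => by simpa using congrFun hv0 i, by simpa using hv⟩

end Calculus

/-! ### The three claims for an arbitrary polynomial. -/

section Polynomial
variable {σ : Type*} [Fintype σ] [DecidableEq σ] {E : Type*} [NormedAddCommGroup E]
  [NormedSpace ℝ E]

/-- For almost every `Λ` and all small `t > 0`, all critical points of `p + ½ ∑ (t Λᵢ xᵢ)²` are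
nondegenerate. -/
theorem ae_nondegenerate [MeasurableSpace E] [BorelSpace E] (μ : Measure E) [μ.IsAddHaarMeasure]
    (e : E ≃L[ℝ] (σ → ℝ)) (p : MvPolynomial σ ℝ) :
    ∀ᵐ Λ ∂μ, ∃ ε : ℝ, 0 < ε ∧ ∀ t ∈ Ioo 0 ε, ∀ w,
      IsCritical (regPoly e p fun i => (t * e Λ i) ^ 2) w →
        IsNondegenerateCritical (regPoly e p fun i => (t * e Λ i) ^ 2) w := by
  obtain ⟨q, hq, hdeg⟩ := exists_polynomial_degenerate p
  -- `expand 2` accounts for the coefficients being squares: the condition is `q(Λ²) ≠ 0`, that is,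
  -- `r(1) ≠ 0` for the restriction `r` of `q` to `t ↦ (tΛ)²`.
  filter_upwards [ae_eval_ne_zero μ e ((expand_ne_zero two_pos).2 hq)] with Λ hΛ
  let r : Polynomial ℝ := aeval (fun i => (Polynomial.X * Polynomial.C (e Λ i)) ^ 2) q
  have hr : ∀ t, r.eval t = eval (fun i => (t * e Λ i) ^ 2) q := by
    intro t
    change Polynomial.evalRingHom t (aeval _ q) = _
    rw [map_aeval, ← eval₂_id]
    simp only [coe_eval₂Hom]
    congr 1
    · ext; simp
    · ext i; simp; ring
  have hr0 : r ≠ 0 := by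
    intro h0
    apply hΛ
    have h1 := hr 1
    rw [h0, Polynomial.eval_zero] at h1
    have h2 : (aeval (e Λ)).comp (expand 2) =
        (aeval fun i => (1 * e Λ i) ^ 2 : MvPolynomial σ ℝ →ₐ[ℝ] ℝ) := by
      ext i; simp
    rw [← aeval_eq_eval, h1, ← aeval_eq_eval, ← h2]
    rfl
  obtain ⟨ε, hε, hball⟩ := mem_nhdsGT_iff_exists_Ioo_subset.1 (eventually_eval_ne_zero hr0)
  refine ⟨ε, hε, fun t ht w hw => ?_⟩
  rw [isCritical_regPoly] at hw
  rw [isNondegenerateCritical_regPoly]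
  refine ⟨hw, fun h0 => hball ht ?_⟩
  rw [hr]
  exact hdeg _ _ hw h0

lemma continuous_aeval_mvPolynomial {σ : Type*} (q : MvPolynomial σ ℝ) :
    Continuous fun x : σ → ℝ => aeval x q := by
  simpa [aeval_eq_eval] using continuous_eval q

lemma contDiff_aeval_mvPolynomial {σ : Type*} [Fintype σ] (q : MvPolynomial σ ℝ) :
    ContDiff ℝ ∞ fun x : σ → ℝ => aeval x q :=
  (AnalyticOnNhd.aeval_mvPolynomial (f := fun x : σ → ℝ => x) (s := univ)
    (fun i => (ContinuousLinearMap.proj (R := ℝ) (φ := fun _ : σ => ℝ) i).analyticOnNhd _) q).contDiff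

lemma contDiff_critEq {σ : Type*} [Fintype σ] (p : MvPolynomial σ ℝ) (i : σ) :
    ContDiff ℝ ∞ fun z : (σ → ℝ) × (σ → ℝ) => critEq p z.1 z.2 i := by
  have h := (contDiff_aeval_mvPolynomial (pderiv i p)).comp
    (contDiff_snd : ContDiff ℝ ∞ (Prod.snd : (σ → ℝ) × (σ → ℝ) → _))
  have h2 : ContDiff ℝ ∞ fun z : (σ → ℝ) × (σ → ℝ) => z.1 i * z.2 i := by fun_prop
  exact ContDiff.add h h2

lemma continuous_critEq {σ : Type*} [Fintype σ] (p : MvPolynomial σ ℝ) (i : σ) :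
    Continuous fun z : (σ → ℝ) × (σ → ℝ) => critEq p z.1 z.2 i :=
  (contDiff_critEq p i).continuous

lemma contDiff_critEq_prod {σ : Type*} [Fintype σ] (p : MvPolynomial σ ℝ) {c : ℝ → σ → ℝ}
    (hc : ContDiff ℝ ∞ c) :
    ContDiff ℝ ∞ fun (z : ℝ × (σ → ℝ)) i => critEq p (c z.1) z.2 i := by
  have hc2 : ContDiff ℝ ∞ fun z : ℝ × (σ → ℝ) => (c z.1, z.2) :=
    (hc.comp contDiff_fst).prodMk contDiff_snd
  rw [contDiff_pi]
  intro i
  have h := ContDiff.comp (contDiff_critEq p i) hc2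
  simp only [Function.comp_def] at h
  exact h

lemma continuous_det_hess (p : MvPolynomial σ ℝ) :
    Continuous fun z : (σ → ℝ) × (σ → ℝ) => (hess p z.1 z.2).det := by
  refine Continuous.matrix_det (continuous_matrix fun i j => ?_)
  have h := (continuous_aeval_mvPolynomial (pderiv j (pderiv i p))).comp
    (continuous_snd : Continuous (Prod.snd : (σ → ℝ) × (σ → ℝ) → _))
  simp only [hess, Matrix.add_apply, Matrix.of_apply]
  refine h.add ?_
  by_cases hij : i = j
  · subst hij; simp only [Matrix.diagonal_apply_eq]; fun_prop
  · simp only [Matrix.diagonal_apply_ne _ hij]; fun_prop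

lemma fderiv_critEq_prod (p : MvPolynomial σ ℝ) {c : ℝ → σ → ℝ}
    (hF : ContDiff ℝ ∞ fun (z : ℝ × (σ → ℝ)) i => critEq p (c z.1) z.2 i) (z : ℝ × (σ → ℝ))
    (v : σ → ℝ) : fderiv ℝ (fun (z : ℝ × (σ → ℝ)) i => critEq p (c z.1) z.2 i) z (0, v) =
      Matrix.mulVec (hess p (c z.1) z.2) v := by
  have h1 := hasFDerivAt_pi.2 fun i =>
    hasFDerivAt_critEq (ContinuousLinearEquiv.refl ℝ (σ → ℝ)) p (c z.1) i z.2
  have h2 := HasFDerivAt.comp z.2 (f := fun x => (z.1, x))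
    (hF.differentiable (by simp) z).hasFDerivAt (hasFDerivAt_prodMk_right (𝕜 := ℝ) z.1 z.2)
  have h4 := congrArg (fun f => f v) (h2.unique h1)
  ext i
  have h5 := congrFun h4 i
  simp [coord] at h5
  rw [h5]
  simp [Matrix.mulVec, dotProduct]

/-- The nondegenerate critical points of `p + ½ ∑ (t Λᵢ xᵢ)²` move along finitely many disjoint
smooth curves, each of which converges to a critical point of `p` or has a coordinate that tends to
infinity. -/
theorem exists_curves (p : MvPolynomial σ ℝ) (Λ : σ → ℝ) :
    ∃ ε : ℝ, 0 < ε ∧ ∃ (N : ℕ) (γ : Fin N → ℝ → σ → ℝ),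
      (∀ q, ContDiffOn ℝ ∞ (γ q) (Ioo 0 ε)) ∧
      (∀ t ∈ Ioo 0 ε, Function.Injective (fun q => γ q t) ∧
        {x | (∀ i, critEq p (fun i => (t * Λ i) ^ 2) x i = 0) ∧
          (hess p (fun i => (t * Λ i) ^ 2) x).det ≠ 0} = range (fun q => γ q t)) ∧
      ∀ q, (∃ x, (∀ i, critEq p 0 x i = 0) ∧ Tendsto (γ q) (𝓝[>] 0) (𝓝 x)) ∨
        ∃ i, Tendsto (fun t => |γ q t i|) (𝓝[>] 0) atTop := by
  let c : ℝ → σ → ℝ := fun t i => (t * Λ i) ^ 2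
  have hc : Continuous c := by fun_prop
  let c' : σ → Polynomial ℝ := fun i => (Polynomial.X * Polynomial.C (Λ i)) ^ 2
  have hc' : ∀ t, (fun k => (c' k).eval t) = c t := by intro t; ext k; simp [c', c]; ring
  choose P hP0 hP using fun j => exists_polynomial_nondegenerate p c' j
  simp only [hc'] at hP
  have hev : ∀ᶠ t in 𝓝[>] (0 : ℝ), ∀ j, (P j).leadingCoeff.eval t ≠ 0 :=
    eventually_all.2 fun j =>
      eventually_eval_ne_zero (Polynomial.leadingCoeff_ne_zero.2 (hP0 j))
  obtain ⟨ε, hε, hlead⟩ := mem_nhdsGT_iff_exists_Ioo_subset.1 hev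
  have hε : 0 < ε := hε
  let F : ℝ × (σ → ℝ) → σ → ℝ := fun z i => critEq p (c z.1) z.2 i
  have hF : ContDiff ℝ ∞ F := by
    have hc1 : ContDiff ℝ ∞ c := by fun_prop
    exact contDiff_critEq_prod p hc1
  let J : ℝ × (σ → ℝ) → ℝ := fun z => (hess p (c z.1) z.2).det
  have hJ : Continuous J := by
    have h1 : Continuous fun z : ℝ × (σ → ℝ) => (c z.1, z.2) :=
      (hc.comp continuous_fst).prodMk continuous_snd
    have h2 := Continuous.comp (continuous_det_hess p) h1
    exact h2
  let Z : Set (ℝ × (σ → ℝ)) := {z | z.1 ∈ Ioo 0 ε ∧ F z = 0 ∧ J z ≠ 0}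
  -- The polynomials for `some i` bound the coordinates. The one for `none` bounds `|J|` away from
  -- `0`, so the open condition `J z ≠ 0` can be replaced by a closed one.
  have hcpt : ∀ a b, 0 < a → b < ε → IsCompact (Z ∩ Icc a b ×ˢ univ) := by
    intro a b ha hb
    have hIcc : ∀ t ∈ Icc a b, t ∈ Ioo 0 ε := fun t ht => ⟨ha.trans_le ht.1, ht.2.trans_lt hb⟩
    choose M hM using fun j => exists_bound_roots (P := P j) (isCompact_Icc (a := a) (b := b))
      fun t ht => hlead (hIcc t ht) j
    have hMZ : ∀ z ∈ Z, z.1 ∈ Icc a b → (∀ i, |z.2 i| ≤ M (some i)) ∧ |(J z)⁻¹| ≤ M none := by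
      intro z hz hzt
      have h1 : ∀ i, critEq p (c z.1) z.2 i = 0 := fun i => congrFun hz.2.1 i
      exact ⟨fun i => hM (some i) _ hzt _ (hP (some i) z.1 z.2 h1 hz.2.2),
        hM none _ hzt _ (hP none z.1 z.2 h1 hz.2.2)⟩
    have hK : IsCompact (Icc a b ×ˢ (univ.pi fun i => Icc (-M (some i)) (M (some i)))) :=
      isCompact_Icc.prod (isCompact_univ_pi fun i => isCompact_Icc)
    have hcl : IsClosed {z | F z = 0 ∧ 1 ≤ M none * |J z|} :=
      (isClosed_eq hF.continuous continuous_const).inter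
        (isClosed_le continuous_const (continuous_const.mul hJ.abs))
    convert hK.inter_right hcl using 1
    ext z
    constructor
    · rintro ⟨hz, hzt, -⟩
      obtain ⟨h1, h2⟩ := hMZ z hz hzt
      refine ⟨⟨hzt, fun i _ => abs_le.1 (h1 i)⟩, hz.2.1, ?_⟩
      rw [abs_inv] at h2
      have h3 : 0 < |J z| := abs_pos.2 hz.2.2
      calc 1 = |J z|⁻¹ * |J z| := (inv_mul_cancel₀ h3.ne').symm
        _ ≤ _ := mul_le_mul_of_nonneg_right h2 h3.le
    · rintro ⟨⟨hzt, -⟩, hz0, hzJ⟩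
      refine ⟨⟨hIcc _ hzt, hz0, fun h0 => ?_⟩, hzt, trivial⟩
      rw [h0] at hzJ
      norm_num at hzJ
  have hnear : ∀ z ∈ Z, ∀ᶠ w in 𝓝 z, F w = 0 → w ∈ Z := by
    intro z hz
    have h1 : ∀ᶠ w in 𝓝 z, w.1 ∈ Ioo 0 ε :=
      continuous_fst.continuousAt.eventually (isOpen_Ioo.mem_nhds hz.1)
    filter_upwards [h1, hJ.continuousAt.eventually_ne hz.2.2] with w hw hwJ hw0
    exact ⟨hw, hw0, hwJ⟩
  have hinj : ∀ z ∈ Z, ∀ v, fderiv ℝ F z (0, v) = 0 → v = 0 := by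
    intro z hz v hv
    refine Matrix.eq_zero_of_mulVec_eq_zero hz.2.2 ?_
    rw [← hv]
    exact (fderiv_critEq_prod p hF z v).symm
  obtain ⟨N, γ, hγ, hγZ⟩ := exists_smooth_sections hF hε (fun z (hz : z ∈ Z) => hz.1)
    (fun z hz => hz.2.1) hnear hinj hcpt
  have hmem : ∀ t ∈ Ioo 0 ε, ∀ q, (t, γ q t) ∈ Z := by
    intro t ht q
    have : γ q t ∈ {x | (t, x) ∈ Z} := (hγZ t ht).2 ▸ ⟨q, rfl⟩
    exact this
  refine ⟨ε, hε, N, γ, hγ, fun t ht => ⟨(hγZ t ht).1, ?_⟩, fun q => ?_⟩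
  · rw [← (hγZ t ht).2]
    ext x
    constructor
    · rintro ⟨h1, h2⟩; exact ⟨ht, funext h1, h2⟩
    · rintro ⟨-, h1, h2⟩; exact ⟨congrFun h1, h2⟩
  have hlim := fun i => tendsto_of_algebraic (hP0 (some i)) hε (g := fun t => γ q t i)
    ((continuous_apply i).comp_continuousOn (hγ q).continuousOn) fun t ht =>
      hP (some i) t (γ q t) (congrFun (hmem t ht q).2.1) (hmem t ht q).2.2
  by_cases hex : ∃ i, Tendsto (fun t => |γ q t i|) (𝓝[>] 0) atTop
  · exact Or.inr hex
  left
  choose x hx using fun i => (hlim i).resolve_right (not_exists.1 hex i)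
  have hx' : Tendsto (γ q) (𝓝[>] 0) (𝓝 x) := tendsto_pi_nhds.2 hx
  refine ⟨x, fun i => ?_, hx'⟩
  have hc0 : Tendsto c (𝓝[>] 0) (𝓝 0) := by
    have : c 0 = 0 := by ext i; simp [c]
    rw [← this]
    exact hc.continuousAt.mono_left nhdsWithin_le_nhds
  have h1 := ((continuous_critEq p i).tendsto ((0 : σ → ℝ), x)).comp (hc0.prodMk_nhds hx')
  refine tendsto_nhds_unique (h1.congr' ?_) tendsto_const_nhds
  filter_upwards [Ioo_mem_nhdsGT hε] with t ht using congrFun (hmem t ht q).2.1 i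

/-- Bounded critical points converge to the critical set of the limit function. -/
theorem tendsto_nhdsSet_critical {σ ι : Type*} [Fintype σ] {l : Filter ι} (p : MvPolynomial σ ℝ)
    {c x : ι → σ → ℝ} (hc : Tendsto c l (𝓝 0)) (hx : ∀ᶠ t in l, ∀ i, critEq p (c t) (x t) i = 0)
    (hbd : ∀ i, ∃ C : ℝ, ∀ᶠ t in l, |x t i| ≤ C) :
    Tendsto x l (𝓝ˢ {y | ∀ i, critEq p 0 y i = 0}) := by
  choose C hC using hbd
  let K : Set (σ → ℝ) := univ.pi fun i => Icc (-C i) (C i)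
  have hK : IsCompact K := isCompact_univ_pi fun i => isCompact_Icc
  have hxK : ∀ᶠ t in l, x t ∈ K := by
    filter_upwards [eventually_all.2 hC] with t ht i _ using abs_le.1 (ht i)
  intro U hU
  obtain ⟨V, hV, hSV, hVU⟩ := mem_nhdsSet_iff_exists.1 hU
  rw [mem_map]
  by_contra hcon
  have hfr : ∃ᶠ t in l, x t ∈ K \ V := by
    have h1 : ∃ᶠ t in l, x t ∉ U :=
      fun h => hcon (h.mono fun t ht => not_not.1 ht)
    exact (Frequently.and_eventually h1 hxK).mono fun t ht => ⟨ht.2, fun h => ht.1 (hVU h)⟩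
  -- A cluster point outside `V` would, by continuity, be critical for `p`, hence in `V`.
  obtain ⟨y, hy, hyc⟩ := (hK.diff hV).exists_mapClusterPt_of_frequently hfr
  refine hy.2 (hSV fun i => ?_)
  obtain ⟨u, hul, hu⟩ := mapClusterPt_iff_ultrafilter.1 hyc
  have h1 := ((continuous_critEq p i).tendsto ((0 : σ → ℝ), y)).comp
    ((hc.mono_left hul).prodMk_nhds hu)
  refine tendsto_nhds_unique (h1.congr' ?_) tendsto_const_nhds
  filter_upwards [hul hx] with t ht using ht i

end Polynomial

/-! ### The network loss as a polynomial in the weights. -/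

section Network
variable {d : ℕ → ℕ}

/-- The positions of the entries of a tuple of weight matrices. -/
abbrev WeightIndex (d : ℕ → ℕ) (n : ℕ) : Type :=
  (i : Fin n) × Fin (d (i + 1)) × Fin (d i)

/-- The entries of a tuple of weight matrices as one vector. -/
noncomputable def flatten (d : ℕ → ℕ) (n : ℕ) : Weights d n ≃L[ℝ] (WeightIndex d n → ℝ) :=
  LinearEquiv.toContinuousLinearEquiv
    { toFun := fun W s => W s.1 s.2.1 s.2.2
      map_add' := fun _ _ => rfl
      map_smul' := fun _ _ => rfl
      invFun := fun x i j k => x ⟨i, j, k⟩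
      left_inv := fun _ => rfl
      right_inv := fun _ => rfl }

lemma flatten_apply {n : ℕ} (W : Weights d n) (s : WeightIndex d n) :
    flatten d n W s = W s.1 s.2.1 s.2.2 := rfl

lemma isAddHaarMeasure_volume (d : ℕ → ℕ) (n : ℕ) :
    (volume : Measure (Weights d n)).IsAddHaarMeasure := by
  have h (a b : ℕ) : (volume : Measure (Fin a → Fin b → ℝ)).IsAddHaarMeasure :=
    Measure.pi.isAddHaarMeasure _
  exact Measure.pi.isAddHaarMeasure _

lemma exists_polynomial_netProd (n : ℕ) (r : Fin (d n)) (k : Fin (d 0)) :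
    ∃ p : MvPolynomial (WeightIndex d n) ℝ, ∀ W, netProd d n W r k = aeval (flatten d n W) p := by
  induction n with
  | zero => exact ⟨C ((1 : Matrix (Fin (d 0)) (Fin (d 0)) ℝ) r k), fun W => by simp [netProd]⟩
  | succ n ih =>
    choose p hp using fun j => ih j
    let f : WeightIndex d n → WeightIndex d (n + 1) := fun s => ⟨s.1.castSucc, s.2⟩
    refine ⟨∑ j, X ⟨Fin.last n, r, j⟩ * rename f (p j), fun W => ?_⟩
    simp only [netProd, Matrix.mul_apply, map_sum, map_mul, aeval_X, hp, aeval_rename]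
    rfl

lemma exists_polynomial_loss {H m : ℕ} (X : Matrix (Fin (d 0)) (Fin m) ℝ)
    (Y : Matrix (Fin (d (H + 1))) (Fin m) ℝ) :
    ∃ p : MvPolynomial (WeightIndex d (H + 1)) ℝ,
      ∀ W, loss X Y W = aeval (flatten d (H + 1) W) p := by
  choose p hp using exists_polynomial_netProd (d := d) (H + 1)
  refine ⟨C (1 / 2) * ∑ c, ∑ r, ((∑ k, p r k * C (X k c)) - C (Y r c)) ^ 2, fun W => ?_⟩
  simp [loss, Matrix.mul_apply, hp]

lemma regLoss_eq_regPoly {H m : ℕ} {X : Matrix (Fin (d 0)) (Fin m) ℝ}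
    {Y : Matrix (Fin (d (H + 1))) (Fin m) ℝ} {p : MvPolynomial (WeightIndex d (H + 1)) ℝ}
    (hp : ∀ W, loss X Y W = aeval (flatten d (H + 1) W) p) (Λ : Weights d (H + 1)) :
    regLoss X Y Λ =
      regPoly (flatten d (H + 1)) p fun s => flatten d (H + 1) Λ s ^ 2 := by
  ext W
  simp only [regLoss, regPoly, hp, flatten_apply, Fintype.sum_sigma, Fintype.sum_prod_type, mul_pow]

lemma loss_eq_regPoly {H m : ℕ} {X : Matrix (Fin (d 0)) (Fin m) ℝ}
    {Y : Matrix (Fin (d (H + 1))) (Fin m) ℝ} {p : MvPolynomial (WeightIndex d (H + 1)) ℝ}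
    (hp : ∀ W, loss X Y W = aeval (flatten d (H + 1) W) p) :
    loss X Y = regPoly (flatten d (H + 1)) p 0 := by
  ext W
  simp [regPoly, hp]

end Network

end DeepLinear

theorem mainTheorem5 (H m : ℕ) (d : ℕ → ℕ) (X : Matrix (Fin (d 0)) (Fin m) ℝ)
    (Y : Matrix (Fin (d (H + 1))) (Fin m) ℝ) :
    -- For almost every `Λ`, all critical points are nondegenerate once `Λ` is scaled down enough.
    (∀ᵐ Λ : DeepLinear.Weights d (H + 1) ∂volume, (∀ i j k, 0 < Λ i j k) →
      ∃ ε : ℝ, 0 < ε ∧ ∀ t ∈ Ioo 0 ε, ∀ W,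
        DeepLinear.IsCritical (DeepLinear.regLoss X Y (t • Λ)) W →
          DeepLinear.IsNondegenerateCritical (DeepLinear.regLoss X Y (t • Λ)) W) ∧
    -- For every `Λ`, as `t` decreases to `0` the nondegenerate critical points for `t • Λ` move
    -- along finitely many disjoint smooth curves, and each curve converges to a critical point of
    -- the unregularized loss or has a coordinate that tends to infinity.
    (∀ Λ : DeepLinear.Weights d (H + 1), (∀ i j k, 0 < Λ i j k) →
      ∃ ε : ℝ, 0 < ε ∧ ∃ N : ℕ, ∃ γ : Fin N → ℝ → DeepLinear.Weights d (H + 1),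
        (∀ p, ContDiffOn ℝ ∞ (γ p) (Ioo 0 ε)) ∧
        (∀ t ∈ Ioo 0 ε, Function.Injective (fun p => γ p t) ∧
          {W | DeepLinear.IsNondegenerateCritical (DeepLinear.regLoss X Y (t • Λ)) W} =
            range (fun p => γ p t)) ∧
        (∀ p,
          (∃ W, DeepLinear.IsCritical (DeepLinear.loss X Y) W ∧
            Tendsto (γ p) (𝓝[>] 0) (𝓝 W)) ∨
          (∃ i j k, Tendsto (fun t => |γ p t i j k|) (𝓝[>] 0) atTop))) ∧
    -- However the coefficients shrink to `0`, any choice of critical points converges to the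
    -- critical set of the unregularized loss or has a coordinate that grows unboundedly.
    (∀ (Λ γ : ℝ → DeepLinear.Weights d (H + 1)),
      (∀ t, 0 < t → ∀ i j k, 0 < Λ t i j k) →
      Tendsto Λ (𝓝[>] 0) (𝓝 0) →
      (∀ t, 0 < t → DeepLinear.IsCritical (DeepLinear.regLoss X Y (Λ t)) (γ t)) →
        Tendsto γ (𝓝[>] 0) (𝓝ˢ {W | DeepLinear.IsCritical (DeepLinear.loss X Y) W}) ∨
        (∃ i j k, ∀ C : ℝ, ∃ᶠ t in 𝓝[>] 0, C < |γ t i j k|)) := by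
  obtain ⟨p, hp⟩ := DeepLinear.exists_polynomial_loss X Y
  let e := DeepLinear.flatten d (H + 1)
  refine ⟨?_, fun Λ _ => ?_, fun Λ γ _ hΛ0 hγ => ?_⟩
  · have := DeepLinear.isAddHaarMeasure_volume d (H + 1)
    filter_upwards [DeepLinear.ae_nondegenerate volume e p] with Λ hΛ _
    obtain ⟨ε, hε, h⟩ := hΛ
    refine ⟨ε, hε, fun t ht W => ?_⟩
    rw [DeepLinear.regLoss_eq_regPoly hp]
    exact h t ht W
  · obtain ⟨ε, hε, N, γ, hγ, hγr, hlim⟩ := DeepLinear.exists_curves p (e Λ)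
    refine ⟨ε, hε, N, fun q t => e.symm (γ q t), fun q => ?_, fun t ht => ⟨?_, ?_⟩, fun q => ?_⟩
    · exact e.symm.contDiff.comp_contDiffOn (hγ q)
    · exact e.symm.injective.comp (hγr t ht).1
    · have hr : range (fun q => e.symm (γ q t)) = e.symm '' range (fun q => γ q t) :=
        range_comp e.symm fun q => γ q t
      rw [hr, ← (hγr t ht).2, DeepLinear.regLoss_eq_regPoly hp, e.symm.image_eq_preimage_symm]
      ext W
      exact DeepLinear.isNondegenerateCritical_regPoly e p _ W
    · rcases hlim q with ⟨x, hx, hqx⟩ | ⟨⟨i, j, k⟩, hi⟩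
      · refine Or.inl ⟨e.symm x, ?_, (e.symm.continuous.tendsto x).comp hqx⟩
        rw [DeepLinear.loss_eq_regPoly hp, DeepLinear.isCritical_regPoly]
        rwa [show DeepLinear.flatten d (H + 1) (e.symm x) = x from e.apply_symm_apply x]
      · exact Or.inr ⟨i, j, k, hi⟩
  · by_cases hex : ∃ i j k, ∀ C : ℝ, ∃ᶠ t in 𝓝[>] 0, C < |γ t i j k|
    · exact Or.inr hex
    left
    have hc : Tendsto (fun t s => e (Λ t) s ^ 2) (𝓝[>] 0) (𝓝 0) := by
      have h1 : Tendsto (fun t => e (Λ t)) (𝓝[>] 0) (𝓝 0) := by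
        have := (e.continuous.tendsto 0).comp hΛ0
        rwa [map_zero] at this
      refine tendsto_pi_nhds.2 fun s => ?_
      have h2 := (tendsto_pi_nhds.1 h1 s).pow 2
      simpa using h2
    have hcrit : ∀ᶠ t in 𝓝[>] (0 : ℝ),
        ∀ s, DeepLinear.critEq p (fun s => e (Λ t) s ^ 2) (e (γ t)) s = 0 := by
      filter_upwards [self_mem_nhdsWithin] with t ht
      have := hγ t ht
      rwa [DeepLinear.regLoss_eq_regPoly hp, DeepLinear.isCritical_regPoly] at this
    -- A coordinate that does not exceed every constant frequently is eventually bounded.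
    have hbd : ∀ s, ∃ C : ℝ, ∀ᶠ t in 𝓝[>] (0 : ℝ), |e (γ t) s| ≤ C := by
      rintro ⟨i, j, k⟩
      by_contra hcon
      refine hex ⟨i, j, k, fun C hC => hcon ⟨C, hC.mono fun t ht => not_lt.1 ht⟩⟩
    have h := DeepLinear.tendsto_nhdsSet_critical p hc hcrit hbd
    intro U hU
    obtain ⟨V, hV, hSV, hVU⟩ := mem_nhdsSet_iff_exists.1 hU
    have hV' : e.symm ⁻¹' V ∈ 𝓝ˢ {y | ∀ s, DeepLinear.critEq p 0 y s = 0} := by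
      refine (hV.preimage e.symm.continuous).mem_nhdsSet.2 fun y hy => hSV ?_
      change DeepLinear.IsCritical _ _
      rw [DeepLinear.loss_eq_regPoly hp, DeepLinear.isCritical_regPoly]
      rwa [show DeepLinear.flatten d (H + 1) (e.symm y) = y from e.apply_symm_apply y]
    filter_upwards [h hV'] with t ht
    have := hVU ht
    simpa using this
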